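/- **Setting.** Let $N,d,k,R\ge 1$. There are $N$ users; user $j$ holds $x_j\in\mathbb R^d$, and a set $S$ of users contributes. In round $r=1,\dots,R$ centroids $\mu^{(r)}_1,\dots,\mu^{(r)}_k\in\mathbb R^d$ are public; $f(x_j,\{\mu^{(r)}\})$ is the index of a centroid closest to $x_j$ in Euclidean distance, chosen uniformly at random among the closest ones (once per user and round). Let $P(f(x_j,\{\mu^{(r)}\})=p)=\frac1N\sum_{j\in S}\Pr[f(x_j,\{\mu^{(r)}\})=p]$, and $P_{\min}=\min_{p,r}P(f(x_j,\{\mu^{(r)}\})=p)$. In the protocol with precision $\epsilon>0$, user $B$ with vector $x_B$ is handed qubits one at a time and returns each of them. In round $r$: (i) $n_1(r)$ times, one qubit for each cluster $p$; if $B$ contributes, $B$ applies $e^{-iZ/2N}$ to the qubit for $p=f(x_B,\{\mu^{(r)}\})$ and nothing to the others; (ii) for each component $i\le d$ and each cluster $p$, $n_2(r,p,i)$ qubits; if $B$ contributes and $p=f(x_B,\{\mu^{(r)}\})$, $B$ applies $e^{-i[x_B]_iZ/2N}$ to each of these, and nothing otherwise. If $B$ does not contribute, $B$ returns all qubits unchanged.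 The numbers of repetitions satisfy $n_1(r)\le A/\epsilon$ and $\sum_{i}n_2(r,p,i)\le A\,d/(\epsilon\,P(f(x_j,\{\mu^{(r)}\})=p))$ for a constant $A$, and the data are bounded, $|[x_B]_i|\le L$ for all $i$. An eavesdropper $E$ controls everything except $B$. A strategy of $E$ consists of a joint, possibly mixed, state of an ancilla of arbitrary finite dimension and the exchanged qubit, arbitrary quantum channels on this joint system between successive interactions with $B$, and a final two-outcome measurement that yields $E$'s guess whether $B$ contributed. $E$'s prior probability that $B$ contributed is $1/2$. Let $P_{\rm opt}$ be the supremum over all strategies of the probability that the guess is correct. **Theorem.** For all $A,L$ there is a constant $C>0$, depending only on $A$ and $L$, such that for all $N,d,k,R\ge1$, all data, centroids, sets $S$, users $B$, repetition numbers and $\epsilon>0$ as above with $P_{\min}>\epsilon$, $$\Bigl|P_{\rm opt}-\tfrac12\Bigr|\;\le\; C\,\frac{R\,d}{P_{\min}\,N\,\epsilon}.$$ -/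

import Mathlib

open scoped Kronecker Matrix ComplexOrder

noncomputable section

namespace QKMeans

/-! ### Classical clustering data -/

/-- The clusters whose centroid is closest (in Euclidean distance) to the vector `v`. -/
def nearest {d k : ℕ} (μ : Fin k → EuclideanSpace ℝ (Fin d)) (v : EuclideanSpace ℝ (Fin d)) :
    Finset (Fin k) :=
  open Classical in Finset.univ.filter fun p => ∀ p', dist v (μ p) ≤ dist v (μ p')

/-- `P(f(x_j, {μ}) = p)`: the probability that a uniformly random one of the `N` users contributes
(is in `S`) and is assigned to cluster `p`, ties between closest clusters being broken uniformly at
random. Without ties this is `#{j ∈ S | f(x_j, {μ}) = p} / N`. The sum over `p` is at most one. -/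
def clusterProb {N d k : ℕ} (x : Fin N → EuclideanSpace ℝ (Fin d)) (S : Finset (Fin N))
    (μ : Fin k → EuclideanSpace ℝ (Fin d)) (p : Fin k) : ℝ :=
  (∑ j ∈ S, if p ∈ nearest μ (x j) then 1 / ((nearest μ (x j)).card : ℝ) else 0) / N

/-- The minimum of `P(f(x_j, {μ⁽ʳ⁾}) = p)` over all clusters `p` and rounds `r`. -/
def minProb {N d k R : ℕ} (x : Fin N → EuclideanSpace ℝ (Fin d)) (S : Finset (Fin N))
    (μ : Fin R → Fin k → EuclideanSpace ℝ (Fin d)) : ℝ :=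
  ⨅ rp : Fin R × Fin k, clusterProb x S (μ rp.1) rp.2

/-! ### The protocol, seen from a participant -/

/-- The occasions on which the participant is handed one qubit, which it returns after having acted
on it: in round `r`, for estimating the weight of cluster `p`, or for estimating component `i` of
the mean of cluster `p`. -/
inductive Slot (R k d : ℕ) : Type
  | weight (r : Fin R) (p : Fin k) : Slot R k d
  | component (r : Fin R) (p : Fin k) (i : Fin d) : Slot R k d

/-- The qubits sent in `R` rounds, in order. In round `r`, first one qubit per cluster is sent, and
this is repeated `n₁ r` times; then, for every component `i` and every cluster `p`, `n₂ r p i` qubits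
are sent. -/
def schedule {R k d : ℕ} (n₁ : Fin R → ℕ) (n₂ : Fin R → Fin k → Fin d → ℕ) : List (Slot R k d) :=
  (List.finRange R).flatMap fun r =>
    (List.replicate (n₁ r) ((List.finRange k).map (Slot.weight r))).flatten ++
    (List.finRange d).flatMap fun i =>
      (List.finRange k).flatMap fun p => List.replicate (n₂ r p i) (Slot.component r p i)

/-- The Pauli matrix `Z`. -/
def pauliZ : Matrix (Fin 2) (Fin 2) ℂ := Matrix.diagonal ![1, -1]

/-- The rotation `exp(-i θ Z)`. -/
def rotZ (θ : ℝ) : Matrix (Fin 2) (Fin 2) ℂ :=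
  NormedSpace.exp ((-(Complex.I * (θ : ℂ))) • pauliZ)

/-- The gate applied to the qubit of a slot by a contributing participant with vector `v` that is
assigned to cluster `c r` in round `r`: `exp(-iZ/2N)`, respectively `exp(-i vᵢ Z/2N)`, if the slot
belongs to its cluster, and the identity otherwise. -/
def gate {R k d : ℕ} (N : ℕ) (v : EuclideanSpace ℝ (Fin d)) (c : Fin R → Fin k) :
    Slot R k d → Matrix (Fin 2) (Fin 2) ℂ
  | .weight r p => if c r = p then rotZ (1 / (2 * N)) else 1
  | .component r p i => if c r = p then rotZ (v i / (2 * N)) else 1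

/-! ### Quantum strategies -/

/-- A quantum channel on a finite-dimensional system, given by Kraus operators. -/
structure Channel (n : Type) [Fintype n] [DecidableEq n] where
  /-- number of Kraus operators -/
  num : ℕ
  /-- Kraus operators -/
  kraus : Fin num → Matrix n n ℂ
  tracePreserving : ∑ a, (kraus a)ᴴ * kraus a = 1

/-- The action of a channel on operators. -/
def Channel.apply {n : Type} [Fintype n] [DecidableEq n] (E : Channel n) (ρ : Matrix n n ℂ) :
    Matrix n n ℂ :=
  ∑ a, E.kraus a * ρ * (E.kraus a)ᴴ

/-- An adaptive strategy of the eavesdropper, who holds an ancilla of arbitrary finite dimension and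
the qubit that is exchanged with the participant: a joint initial state (possibly mixed and
entangled), the channel that is applied after the `t`-th qubit has come back (and before the next
one is sent), and a final two-outcome measurement with effect `yes` for the guess
"has participated" and effect `1 - yes` for "has not participated". Strategies that send several
qubits at once, or the same qubit several times, are special cases. -/
structure Strategy where
  /-- dimension of the ancilla -/
  m : ℕ
  /-- initial state -/
  ρ : Matrix (Fin m × Fin 2) (Fin m × Fin 2) ℂ
  ρ_psd : ρ.PosSemidef
  ρ_trace : ρ.trace = 1
  /-- channels applied between the interactions -/
  chan : ℕ → Channel (Fin m × Fin 2)
  /-- effect of the outcome "has participated" -/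
  yes : Matrix (Fin m × Fin 2) (Fin m × Fin 2) ℂ
  yes_psd : yes.PosSemidef
  no_psd : (1 - yes).PosSemidef

/-- The final joint state, if the gates in the list are successively applied to the qubit. -/
def evolve {m : ℕ} : List (Matrix (Fin 2) (Fin 2) ℂ) → (ℕ → Channel (Fin m × Fin 2)) →
    Matrix (Fin m × Fin 2) (Fin m × Fin 2) ℂ → Matrix (Fin m × Fin 2) (Fin m × Fin 2) ℂ
  | [], _, ρ => ρ
  | g :: gs, E, ρ =>
    evolve gs (fun t => E (t + 1))
      ((E 0).apply (((1 : Matrix (Fin m) (Fin m) ℂ) ⊗ₖ g) * ρ *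
        ((1 : Matrix (Fin m) (Fin m) ℂ) ⊗ₖ g)ᴴ))

/-- The probability that the strategy guesses "has participated", when the participant applies the
given gates. -/
def Strategy.probYes (A : Strategy) (gs : List (Matrix (Fin 2) (Fin 2) ℂ)) : ℝ :=
  (A.yes * evolve gs A.chan A.ρ).trace.re

/-- The probability that the strategy guesses "has not participated", when the participant applies
the given gates. -/
def Strategy.probNo (A : Strategy) (gs : List (Matrix (Fin 2) (Fin 2) ℂ)) : ℝ :=
  ((1 - A.yes) * evolve gs A.chan A.ρ).trace.re

/-- The probability that the strategy correctly decides whether the participant with vector `v` took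
part, with prior probability `1/2`. A participant that takes part draws, in every round,
independently and uniformly one of its closest clusters; one that does not take part applies the
identity throughout. -/
def Strategy.success {R k d : ℕ} (A : Strategy) (N : ℕ) (v : EuclideanSpace ℝ (Fin d))
    (μ : Fin R → Fin k → EuclideanSpace ℝ (Fin d)) (n₁ : Fin R → ℕ)
    (n₂ : Fin R → Fin k → Fin d → ℕ) : ℝ :=
  1 / 2 * ((∑ c ∈ Fintype.piFinset fun r => nearest (μ r) v,
      A.probYes ((schedule n₁ n₂).map (gate N v c))) /
        ((Fintype.piFinset fun r => nearest (μ r) v).card : ℝ)) +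
  1 / 2 * A.probNo ((schedule n₁ n₂).map fun _ => 1)

end QKMeans

end

/-! A participant differs from a non-participant only by rotations `exp(-iθZ)` with angles of order
`1/N`, and an adaptive strategy cannot amplify their total angle by more than a constant. This is a
hybrid argument: the rotations are replaced by the identity one at a time, and each replacement
moves the probability of any effect by at most `3|θ|` (`functional_rotation_le`,
`abs_trace_evolve_rotZ_sub_le`). No trace norm is needed. Conjugation by a rotation is a real
combination of three positive maps (`rotation_conj`), and on each of these an effect has a value
between zero and the trace. In each round only the assigned cluster contributes to the total angle,
so the bounds on the repetitions give a multiple of `R d / (P_min N ε)` without a factor `k`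
(`sum_abs_gateAngle_le`). Half the resulting gap bounds the advantage from above (`success_le`);
constant guessing attains `1/2` (`guessNo`). -/

namespace QKMeans

/-! ### Linearity, positivity and trace preservation of the evolution -/

section Evolution

variable {m : ℕ}

lemma channel_apply_add {n : Type} [Fintype n] [DecidableEq n] (E : Channel n)
    (ρ σ : Matrix n n ℂ) : E.apply (ρ + σ) = E.apply ρ + E.apply σ := by
  simp [Channel.apply, mul_add, add_mul, Finset.sum_add_distrib]

lemma channel_apply_smul {n : Type} [Fintype n] [DecidableEq n] (E : Channel n)
    (z : ℂ) (ρ : Matrix n n ℂ) : E.apply (z • ρ) = z • E.apply ρ := by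
  simp [Channel.apply, Finset.smul_sum]

lemma channel_apply_posSemidef {n : Type} [Fintype n] [DecidableEq n] (E : Channel n)
    {ρ : Matrix n n ℂ} (h : ρ.PosSemidef) : (E.apply ρ).PosSemidef :=
  Matrix.posSemidef_sum _ fun a _ => h.mul_mul_conjTranspose_same (E.kraus a)

lemma channel_apply_trace {n : Type} [Fintype n] [DecidableEq n] (E : Channel n)
    (ρ : Matrix n n ℂ) : (E.apply ρ).trace = ρ.trace := by
  have h : (E.apply ρ).trace = ((∑ a, (E.kraus a)ᴴ * E.kraus a) * ρ).trace := by
    simp only [Channel.apply, Matrix.trace_sum, Finset.sum_mul]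
    refine Finset.sum_congr rfl fun a _ => ?_
    rw [Matrix.trace_mul_comm, ← mul_assoc]
  rw [h, E.tracePreserving, one_mul]

lemma evolve_add (gs : List (Matrix (Fin 2) (Fin 2) ℂ)) (E : ℕ → Channel (Fin m × Fin 2))
    (ρ σ : Matrix (Fin m × Fin 2) (Fin m × Fin 2) ℂ) :
    evolve gs E (ρ + σ) = evolve gs E ρ + evolve gs E σ := by
  induction gs generalizing E ρ σ with
  | nil => rfl
  | cons g gs ih => simp only [evolve, mul_add, add_mul, channel_apply_add, ih]

lemma evolve_smul (gs : List (Matrix (Fin 2) (Fin 2) ℂ)) (E : ℕ → Channel (Fin m × Fin 2))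
    (z : ℂ) (ρ : Matrix (Fin m × Fin 2) (Fin m × Fin 2) ℂ) :
    evolve gs E (z • ρ) = z • evolve gs E ρ := by
  induction gs generalizing E ρ with
  | nil => rfl
  | cons g gs ih =>
    simp only [evolve, Matrix.mul_smul, Matrix.smul_mul, channel_apply_smul, ih]

lemma evolve_posSemidef (gs : List (Matrix (Fin 2) (Fin 2) ℂ)) (E : ℕ → Channel (Fin m × Fin 2))
    {ρ : Matrix (Fin m × Fin 2) (Fin m × Fin 2) ℂ} (h : ρ.PosSemidef) :
    (evolve gs E ρ).PosSemidef := by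
  induction gs generalizing E ρ with
  | nil => exact h
  | cons g gs ih =>
    exact ih _ (channel_apply_posSemidef _ (h.mul_mul_conjTranspose_same _))

lemma trace_conj_of_unitary {n : Type} [Fintype n] [DecidableEq n] {U : Matrix n n ℂ}
    (hU : Uᴴ * U = 1) (ρ : Matrix n n ℂ) : (U * ρ * Uᴴ).trace = ρ.trace := by
  rw [Matrix.trace_mul_comm, ← mul_assoc, hU, one_mul]

lemma one_kronecker_unitary {g : Matrix (Fin 2) (Fin 2) ℂ} (hg : gᴴ * g = 1) :
    ((1 : Matrix (Fin m) (Fin m) ℂ) ⊗ₖ g)ᴴ * ((1 : Matrix (Fin m) (Fin m) ℂ) ⊗ₖ g) = 1 := by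
  rw [Matrix.conjTranspose_kronecker, ← Matrix.mul_kronecker_mul, hg]
  simp

lemma evolve_trace (gs : List (Matrix (Fin 2) (Fin 2) ℂ)) (hgs : ∀ g ∈ gs, gᴴ * g = 1)
    (E : ℕ → Channel (Fin m × Fin 2)) (ρ : Matrix (Fin m × Fin 2) (Fin m × Fin 2) ℂ) :
    (evolve gs E ρ).trace = ρ.trace := by
  induction gs generalizing E ρ with
  | nil => rfl
  | cons g gs ih =>
    rw [evolve, ih (fun g' h => hgs g' (List.mem_cons_of_mem _ h)), channel_apply_trace,
      trace_conj_of_unitary (one_kronecker_unitary (hgs g List.mem_cons_self))]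

end Evolution

open scoped MatrixOrder Matrix.Norms.L2Operator in
/-- The product of two positive semidefinite matrices has nonnegative trace. -/
lemma trace_mul_re_nonneg {n : Type} [Fintype n] [DecidableEq n] {M ρ : Matrix n n ℂ}
    (hM : M.PosSemidef) (hρ : ρ.PosSemidef) : 0 ≤ (M * ρ).trace.re := by
  -- With `M = B* B`, cyclicity turns the trace into that of `B ρ B*`, which is positive
  -- semidefinite.
  obtain ⟨B, hB⟩ := (CStarAlgebra.nonneg_iff_eq_star_mul_self (a := M)).mp hM.nonneg
  have h := (hρ.mul_mul_conjTranspose_same B).trace_nonneg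
  rw [hB, Matrix.star_eq_conjTranspose, mul_assoc, Matrix.trace_mul_comm]
  exact (Complex.le_def.mp h).1

lemma trace_mul_re_le {n : Type} [Fintype n] [DecidableEq n] {M ρ : Matrix n n ℂ}
    (hM : (1 - M).PosSemidef) (hρ : ρ.PosSemidef) : (M * ρ).trace.re ≤ ρ.trace.re := by
  have h := trace_mul_re_nonneg hM hρ
  rw [sub_mul, one_mul, Matrix.trace_sub, Complex.sub_re] at h
  linarith

/-! ### Rotations -/

lemma rotZ_eq (θ : ℝ) :
    rotZ θ = (Real.cos θ : ℂ) • 1 - (Complex.I * (Real.sin θ : ℂ)) • pauliZ := by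
  have h : (-(Complex.I * (θ : ℂ))) • pauliZ
      = Matrix.diagonal ![-(θ * Complex.I), θ * Complex.I] := by
    ext i j
    fin_cases i <;> fin_cases j <;> simp [pauliZ, mul_comm]
  rw [rotZ, h, Matrix.exp_diagonal]
  ext i j
  fin_cases i <;> fin_cases j <;>
    simp [pauliZ, Pi.coe_exp, ← Complex.exp_eq_exp_ℂ, Complex.exp_mul_I,
      ← neg_mul]
  all_goals ring

lemma pauliZ_mul_self : pauliZ * pauliZ = 1 := by
  ext i j
  fin_cases i <;> fin_cases j <;> simp [pauliZ]

lemma pauliZ_conjTranspose : pauliZᴴ = pauliZ := by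
  ext i j
  fin_cases i <;> fin_cases j <;> simp [pauliZ, Matrix.conjTranspose_apply]

lemma rotZ_zero : rotZ 0 = 1 := by simp [rotZ_eq]

lemma rotation_unitary {n : Type} [Fintype n] [DecidableEq n] {z : Matrix n n ℂ}
    (hz : z * z = 1) (hz' : zᴴ = z) (θ : ℝ) :
    ((Real.cos θ : ℂ) • 1 - (Complex.I * (Real.sin θ : ℂ)) • z)ᴴ *
      ((Real.cos θ : ℂ) • 1 - (Complex.I * (Real.sin θ : ℂ)) • z) = 1 := by
  have h : (Real.cos θ : ℂ) ^ 2 + (Real.sin θ : ℂ) ^ 2 = 1 := by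
    exact_mod_cast Real.cos_sq_add_sin_sq θ
  simp only [Matrix.conjTranspose_sub, Matrix.conjTranspose_smul, hz', Matrix.conjTranspose_one,
    sub_mul, mul_sub, Matrix.smul_mul, Matrix.mul_smul, hz, one_mul, mul_one, star_mul',
    Complex.star_def, Complex.conj_I, Complex.conj_ofReal]
  match_scalars
  · push_cast at h ⊢
    linear_combination h - (Complex.sin θ : ℂ) ^ 2 * Complex.I_sq
  · ring

lemma rotZ_unitary (θ : ℝ) : (rotZ θ)ᴴ * rotZ θ = 1 := by
  rw [rotZ_eq]
  exact rotation_unitary pauliZ_mul_self pauliZ_conjTranspose θ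

/-- Conjugation by a rotation about an involution is a combination of conjugation by the
identity, by the involution, and by the rotation through `π / 4`. -/
lemma rotation_conj {n : Type} [Fintype n] [DecidableEq n] {z : Matrix n n ℂ}
    (hz' : zᴴ = z) (ρ : Matrix n n ℂ) (c s : ℝ) :
    ((c : ℂ) • 1 - (Complex.I * (s : ℂ)) • z) * ρ * ((c : ℂ) • 1 - (Complex.I * (s : ℂ)) • z)ᴴ
      = ((c ^ 2 - s * c : ℝ) : ℂ) • ρ + ((s ^ 2 - s * c : ℝ) : ℂ) • (z * ρ * zᴴ)
        + ((s * c : ℝ) : ℂ) • ((1 - Complex.I • z) * ρ * (1 - Complex.I • z)ᴴ) := by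
  simp only [Matrix.conjTranspose_sub, Matrix.conjTranspose_smul, hz', Matrix.conjTranspose_one,
    sub_mul, mul_sub, Matrix.smul_mul, Matrix.mul_smul, one_mul, mul_one, star_mul',
    Complex.star_def, Complex.conj_I, Complex.conj_ofReal]
  match_scalars <;> ring_nf <;> simp

/-- A linear functional with values in `[0, tr σ]` on positive semidefinite `σ` changes by at most
`3 |θ|` when a state is rotated by the angle `θ`. -/
lemma functional_rotation_le {n : Type} [Fintype n] [DecidableEq n] {z : Matrix n n ℂ}
    (hz : z * z = 1) (hz' : zᴴ = z) (φ : Matrix n n ℂ →ₗ[ℂ] ℂ)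
    (h0 : ∀ σ : Matrix n n ℂ, σ.PosSemidef → 0 ≤ (φ σ).re)
    (h1 : ∀ σ : Matrix n n ℂ, σ.PosSemidef → (φ σ).re ≤ σ.trace.re)
    {ρ : Matrix n n ℂ} (hρ : ρ.PosSemidef) (htr : ρ.trace = 1) (θ : ℝ) :
    |(φ (((Real.cos θ : ℂ) • 1 - (Complex.I * (Real.sin θ : ℂ)) • z) * ρ *
        ((Real.cos θ : ℂ) • 1 - (Complex.I * (Real.sin θ : ℂ)) • z)ᴴ)).re - (φ ρ).re|
      ≤ 3 * |θ| := by
  have hzz : zᴴ * z = 1 := by rw [hz', hz]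
  -- `1 - iz` is `√2` times a unitary, so its conjugation doubles the trace: below, `a` and `b` lie
  -- in `[0, 1]` and `w` in `[0, 2]`.
  have hw : (1 - Complex.I • z)ᴴ * (1 - Complex.I • z) = (2 : ℂ) • 1 := by
    simp only [Matrix.conjTranspose_sub, Matrix.conjTranspose_smul, hz', Matrix.conjTranspose_one,
      sub_mul, mul_sub, Matrix.smul_mul, Matrix.mul_smul, one_mul, mul_one, Complex.star_def,
      Complex.conj_I, hz]
    match_scalars
    · linear_combination -Complex.I_sq
    · ring
  have a0 := h0 _ hρ
  have a1 := h1 _ hρ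
  have b0 := h0 _ (hρ.mul_mul_conjTranspose_same z)
  have b1 := h1 _ (hρ.mul_mul_conjTranspose_same z)
  have c0 := h0 _ (hρ.mul_mul_conjTranspose_same (1 - Complex.I • z))
  have c1 := h1 _ (hρ.mul_mul_conjTranspose_same (1 - Complex.I • z))
  rw [trace_conj_of_unitary hzz, htr, Complex.one_re] at b1
  rw [Matrix.trace_mul_comm, ← mul_assoc, hw, Matrix.smul_mul, one_mul, Matrix.trace_smul,
    htr] at c1
  rw [htr, Complex.one_re] at a1
  simp only [smul_eq_mul, mul_one, Complex.re_ofNat] at c1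
  rw [rotation_conj hz']
  simp only [map_add, map_smul, smul_eq_mul, Complex.add_re, Complex.re_ofReal_mul]
  generalize (φ ρ).re = a at *
  generalize (φ (z * ρ * zᴴ)).re = b at *
  generalize (φ ((1 - Complex.I • z) * ρ * (1 - Complex.I • z)ᴴ)).re = w at *
  have hcs := Real.cos_sq_add_sin_sq θ
  -- The change carries a factor `sin θ`, which supplies `|θ|`. The cofactor is at most `1 + 2 = 3`,
  -- since `|b - a| ≤ 1` and `|w - a - b| ≤ 2`.
  have e : (Real.cos θ ^ 2 - Real.sin θ * Real.cos θ) * a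
      + (Real.sin θ ^ 2 - Real.sin θ * Real.cos θ) * b + Real.sin θ * Real.cos θ * w - a
      = Real.sin θ * (Real.sin θ * (b - a) + Real.cos θ * (w - a - b)) := by
    linear_combination a * hcs
  rw [e, abs_mul]
  have hs : |Real.sin θ| ≤ |θ| := Real.abs_sin_le_abs
  have ht : |Real.sin θ * (b - a) + Real.cos θ * (w - a - b)| ≤ 3 := by
    have t1 : |Real.sin θ * (b - a)| ≤ 1 * 1 := by
      rw [abs_mul]
      exact mul_le_mul (Real.abs_sin_le_one θ) (abs_le.mpr ⟨by linarith, by linarith⟩)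
        (abs_nonneg _) zero_le_one
    have t2 : |Real.cos θ * (w - a - b)| ≤ 1 * 2 := by
      rw [abs_mul]
      exact mul_le_mul (Real.abs_cos_le_one θ) (abs_le.mpr ⟨by linarith, by linarith⟩)
        (abs_nonneg _) zero_le_one
    linarith [abs_add_le (Real.sin θ * (b - a)) (Real.cos θ * (w - a - b))]
  calc _ ≤ |θ| * 3 := mul_le_mul hs ht (abs_nonneg _) (abs_nonneg _)
    _ = _ := mul_comm _ _

/-- `1 ⊗ Z` is again a Hermitian involution, so the rotation estimate applies to the joint system
with the same angle. -/
lemma one_kronecker_rotZ (m : ℕ) (θ : ℝ) :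
    (1 : Matrix (Fin m) (Fin m) ℂ) ⊗ₖ rotZ θ
      = (Real.cos θ : ℂ) • 1 - (Complex.I * (Real.sin θ : ℂ)) • (1 ⊗ₖ pauliZ) := by
  rw [rotZ_eq, sub_eq_add_neg, Matrix.kronecker_add, ← neg_smul, Matrix.kronecker_smul,
    Matrix.kronecker_smul, Matrix.one_kronecker_one, neg_smul, ← sub_eq_add_neg]

/-- Replacing the rotations by the identity changes the probability of an effect by at most three
times the sum of the angles. -/
lemma abs_trace_evolve_rotZ_sub_le {m : ℕ} {M : Matrix (Fin m × Fin 2) (Fin m × Fin 2) ℂ}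
    (hM : M.PosSemidef) (hM' : (1 - M).PosSemidef) {α : Type} (θ : α → ℝ) (l : List α)
    (E : ℕ → Channel (Fin m × Fin 2)) {ρ : Matrix (Fin m × Fin 2) (Fin m × Fin 2) ℂ}
    (hρ : ρ.PosSemidef) (htr : ρ.trace = 1) :
    |(M * evolve (l.map fun a => rotZ (θ a)) E ρ).trace.re
        - (M * evolve (l.map fun _ => 1) E ρ).trace.re| ≤ 3 * (l.map fun a => |θ a|).sum := by
  induction l generalizing E ρ with
  | nil => simp
  | cons a l ih =>
    simp only [List.map_cons, List.sum_cons, evolve]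
    have hU := one_kronecker_unitary (m := m) (rotZ_unitary (θ a))
    -- The intermediate hybrid keeps the first rotation and has the identity in all later slots. The
    -- induction hypothesis, started from the rotated state, reaches this hybrid.
    have step := ih (fun t => E (t + 1))
      (channel_apply_posSemidef (E 0) (hρ.mul_mul_conjTranspose_same (1 ⊗ₖ rotZ (θ a))))
      (by rw [channel_apply_trace, trace_conj_of_unitary hU, htr])
    -- Everything after the first gate of the hybrid, including the measurement, is one linear
    -- functional of the state; `hrot` then removes the first rotation.
    let φ : Matrix (Fin m × Fin 2) (Fin m × Fin 2) ℂ →ₗ[ℂ] ℂ :=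
      { toFun := fun σ =>
          (M * evolve (l.map fun _ => 1) (fun t => E (t + 1)) ((E 0).apply σ)).trace
        map_add' := fun σ τ => by
          simp only [channel_apply_add, evolve_add, mul_add, Matrix.trace_add]
        map_smul' := fun w σ => by
          simp only [channel_apply_smul, evolve_smul, Matrix.mul_smul, Matrix.trace_smul,
            RingHom.id_apply] }
    have hpsd : ∀ σ : Matrix (Fin m × Fin 2) (Fin m × Fin 2) ℂ, σ.PosSemidef →
        (evolve (l.map fun _ => 1) (fun t => E (t + 1)) ((E 0).apply σ)).PosSemidef :=
      fun σ hσ => evolve_posSemidef _ _ (channel_apply_posSemidef _ hσ)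
    have hrot := functional_rotation_le
      (z := (1 : Matrix (Fin m) (Fin m) ℂ) ⊗ₖ pauliZ)
      (by rw [← Matrix.mul_kronecker_mul, pauliZ_mul_self, one_mul, Matrix.one_kronecker_one])
      (by rw [Matrix.conjTranspose_kronecker, pauliZ_conjTranspose, Matrix.conjTranspose_one])
      φ (fun σ hσ => trace_mul_re_nonneg hM (hpsd σ hσ))
      (fun σ hσ => (trace_mul_re_le hM' (hpsd σ hσ)).trans_eq (by
        rw [evolve_trace _ (by simp), channel_apply_trace])) hρ htr (θ a)
    rw [← one_kronecker_rotZ] at hrot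
    simp only [Matrix.one_kronecker_one, Matrix.conjTranspose_one, one_mul, mul_one]
    refine (abs_sub_le _ _ _).trans ((add_le_add step hrot).trans_eq (by ring))

/-! ### Angles of the protocol -/

/-- The rotation angle of the gate applied in a slot. -/
noncomputable def gateAngle {R k d : ℕ} (N : ℕ) (v : EuclideanSpace ℝ (Fin d)) (c : Fin R → Fin k) :
    Slot R k d → ℝ
  | .weight r p => if c r = p then 1 / (2 * N) else 0
  | .component r p i => if c r = p then v i / (2 * N) else 0

/-- The identity counts as a rotation by zero, so all slots are treated uniformly. -/
lemma gate_eq_rotZ {R k d : ℕ} (N : ℕ) (v : EuclideanSpace ℝ (Fin d)) (c : Fin R → Fin k)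
    (s : Slot R k d) : gate N v c s = rotZ (gateAngle N v c s) := by
  cases s <;> simp only [gate, gateAngle] <;> split_ifs <;> simp [rotZ_zero]

lemma sum_flatMap_finRange {α : Type} {n : ℕ} (f : Fin n → List α) (g : α → ℝ) :
    (((List.finRange n).flatMap f).map g).sum = ∑ i, ((f i).map g).sum := by
  rw [Fin.sum_univ_def]
  induction List.finRange n with
  | nil => simp
  | cons a l ih => simp [ih]

lemma sum_flatten_replicate {α : Type} (n : ℕ) (l : List α) (g : α → ℝ) :
    (((List.replicate n l).flatten).map g).sum = n * (l.map g).sum := by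
  induction n with
  | zero => simp
  | succ n ih => simp only [List.replicate_succ, List.flatten_cons, List.map_append,
      List.sum_append, ih]; push_cast; ring

/-- Slots of clusters other than `c r` have angle zero, so each sum over clusters collapses to one
term. -/
lemma sum_abs_gateAngle {R k d : ℕ} (N : ℕ) (v : EuclideanSpace ℝ (Fin d)) (c : Fin R → Fin k)
    (n₁ : Fin R → ℕ) (n₂ : Fin R → Fin k → Fin d → ℕ) :
    ((schedule n₁ n₂).map fun s => |gateAngle N v c s|).sum
      = ∑ r, (n₁ r * (1 / (2 * N) : ℝ) + ∑ i, n₂ r (c r) i * (|v i| / (2 * N))) := by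
  rw [schedule, sum_flatMap_finRange]
  refine Finset.sum_congr rfl fun r _ => ?_
  rw [List.map_append, List.sum_append, sum_flatten_replicate, sum_flatMap_finRange,
    List.map_map, ← Fin.sum_univ_def]
  congr 1
  · congr 1
    rw [Finset.sum_eq_single (c r)]
    · simp [gateAngle, abs_of_nonneg]
    · intro p _ hp
      simp [gateAngle, hp.symm]
    · simp
  · refine Finset.sum_congr rfl fun i _ => ?_
    rw [sum_flatMap_finRange, Finset.sum_eq_single (c r)]
    · simp [gateAngle, abs_div]
    · intro p _ hp
      simp [gateAngle, hp.symm]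
    · simp

/-! ### Cluster probabilities -/

lemma nearest_nonempty {d k : ℕ} (hk : 0 < k) (μ : Fin k → EuclideanSpace ℝ (Fin d))
    (v : EuclideanSpace ℝ (Fin d)) : (nearest μ v).Nonempty := by
  have : Nonempty (Fin k) := ⟨⟨0, hk⟩⟩
  obtain ⟨p, hp⟩ := Finite.exists_min fun p => dist v (μ p)
  exact ⟨p, by simpa [nearest] using hp⟩

/-- This yields `P_min ≤ 1`, which lets the bound `A / ε` for the weight estimation be absorbed into
the one for the components. -/
lemma clusterProb_le_one {N d k : ℕ} (x : Fin N → EuclideanSpace ℝ (Fin d)) (S : Finset (Fin N))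
    (μ : Fin k → EuclideanSpace ℝ (Fin d)) (p : Fin k) : clusterProb x S μ p ≤ 1 := by
  refine div_le_one_of_le₀ ?_ (Nat.cast_nonneg N)
  calc _ ≤ ∑ _j ∈ S, (1 : ℝ) := Finset.sum_le_sum fun j _ => by
        split_ifs
        · rw [one_div]
          exact Nat.cast_inv_le_one _
        · exact zero_le_one
    _ = S.card := by simp
    _ ≤ N := by exact_mod_cast (Finset.card_le_univ S).trans_eq (Fintype.card_fin N)

lemma minProb_le {N d k R : ℕ} (x : Fin N → EuclideanSpace ℝ (Fin d)) (S : Finset (Fin N))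
    (μ : Fin R → Fin k → EuclideanSpace ℝ (Fin d)) (r : Fin R) (p : Fin k) :
    minProb x S μ ≤ clusterProb x S (μ r) p :=
  ciInf_le (Set.finite_range fun rp : Fin R × Fin k => clusterProb x S (μ rp.1) rp.2).bddBelow
    (r, p)

/-- The total rotation angle of a participant, in terms of the bounds on the repetitions. -/
lemma sum_abs_gateAngle_le {A L : ℝ} {N d k R : ℕ} (hd : 0 < d)
    (x : Fin N → EuclideanSpace ℝ (Fin d)) (b : Fin N) (S : Finset (Fin N))
    (μ : Fin R → Fin k → EuclideanSpace ℝ (Fin d)) {ε : ℝ}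
    (n₁ : Fin R → ℕ) (n₂ : Fin R → Fin k → Fin d → ℕ) (hε : 0 < ε) (hx : ∀ i, |x b i| ≤ L)
    (h₁ : ∀ r, (n₁ r : ℝ) ≤ A / ε)
    (h₂ : ∀ r p, ((∑ i, n₂ r p i : ℕ) : ℝ) ≤ A * d / (ε * clusterProb x S (μ r) p))
    (hP : 0 < minProb x S μ) (c : Fin R → Fin k) :
    ((schedule n₁ n₂).map fun s => |gateAngle N (x b) c s|).sum
      ≤ |A| * (1 + |L|) / 2 * (R * d / (minProb x S μ * N * ε)) := by
  have hN : (0 : ℝ) < N := by exact_mod_cast b.pos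
  have hd1 : (1 : ℝ) ≤ d := by exact_mod_cast hd
  rw [sum_abs_gateAngle]
  have key : ∀ r, (n₁ r * (1 / (2 * N) : ℝ) + ∑ i, n₂ r (c r) i * (|x b i| / (2 * N)))
      ≤ |A| * (1 + |L|) / 2 * (d / (minProb x S μ * N * ε)) := by
    intro r
    have hle := minProb_le x S μ r (c r)
    have hP1 : minProb x S μ ≤ 1 := hle.trans (clusterProb_le_one _ _ _ _)
    -- Both kinds of repetitions get the same bound: here by `d ≥ 1` and `P_min ≤ 1`, in `e₂` by
    -- `P_min ≤ P(f = c r)`. Taking `|A|` keeps the numerators nonnegative.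
    have e₁ : (n₁ r : ℝ) ≤ |A| * d / (ε * minProb x S μ) := by
      refine (h₁ r).trans (div_le_div₀ (by positivity) ?_ (by positivity) ?_)
      · exact (le_abs_self A).trans (le_mul_of_one_le_right (abs_nonneg A) hd1)
      · exact mul_le_of_le_one_right hε.le hP1
    have e₂ : ∑ i, (n₂ r (c r) i : ℝ) ≤ |A| * d / (ε * minProb x S μ) := by
      have h := h₂ r (c r)
      push_cast at h
      refine h.trans (div_le_div₀ (by positivity) ?_ (by positivity) ?_)
      · exact mul_le_mul_of_nonneg_right (le_abs_self A) (Nat.cast_nonneg d)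
      · exact mul_le_mul_of_nonneg_left hle hε.le
    have e₃ : ∑ i, n₂ r (c r) i * (|x b i| / (2 * N))
        ≤ (|A| * d / (ε * minProb x S μ)) * (|L| / (2 * N)) := by
      calc _ ≤ ∑ i, (n₂ r (c r) i : ℝ) * (|L| / (2 * N)) := by
            refine Finset.sum_le_sum fun i _ => ?_
            have := (hx i).trans (le_abs_self L)
            gcongr
        _ = (∑ i, (n₂ r (c r) i : ℝ)) * (|L| / (2 * N)) := by rw [Finset.sum_mul]
        _ ≤ _ := mul_le_mul_of_nonneg_right e₂ (by positivity)
    calc _ ≤ (|A| * d / (ε * minProb x S μ)) * (1 / (2 * N))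
          + (|A| * d / (ε * minProb x S μ)) * (|L| / (2 * N)) :=
        add_le_add (mul_le_mul_of_nonneg_right e₁ (by positivity)) e₃
      _ = _ := by field_simp
  calc _ ≤ ∑ _r : Fin R, |A| * (1 + |L|) / 2 * (d / (minProb x S μ * N * ε)) :=
        Finset.sum_le_sum fun r _ => key r
    _ = _ := by simp only [Finset.sum_const, Finset.card_univ, Fintype.card_fin, nsmul_eq_mul]; ring

/-! ### Success probabilities -/

lemma probNo_eq (T : Strategy) (gs : List (Matrix (Fin 2) (Fin 2) ℂ))
    (hgs : ∀ g ∈ gs, gᴴ * g = 1) : T.probNo gs = 1 - T.probYes gs := by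
  simp [Strategy.probNo, Strategy.probYes, sub_mul, Matrix.trace_sub, evolve_trace gs hgs,
    T.ρ_trace]

lemma abs_probYes_sub_le (T : Strategy) {R k d : ℕ} (N : ℕ) (v : EuclideanSpace ℝ (Fin d))
    (c : Fin R → Fin k) (l : List (Slot R k d)) :
    |T.probYes (l.map (gate N v c)) - T.probYes (l.map fun _ => 1)|
      ≤ 3 * (l.map fun s => |gateAngle N v c s|).sum := by
  rw [show gate N v c = fun s => rotZ (gateAngle N v c s) from funext (gate_eq_rotZ N v c)]
  exact abs_trace_evolve_rotZ_sub_le T.yes_psd T.no_psd _ l T.chan T.ρ_psd T.ρ_trace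

/-- The success probability is `1/2` plus half the difference of the two probabilities of guessing
"yes". Averaging over ties preserves a bound that holds for every assignment `c`. -/
lemma success_le {R k d : ℕ} (hk : 0 < k) (T : Strategy) (N : ℕ) (v : EuclideanSpace ℝ (Fin d))
    (μ : Fin R → Fin k → EuclideanSpace ℝ (Fin d)) (n₁ : Fin R → ℕ)
    (n₂ : Fin R → Fin k → Fin d → ℕ) {K : ℝ}
    (hK : ∀ c : Fin R → Fin k, ((schedule n₁ n₂).map fun s => |gateAngle N v c s|).sum ≤ K) :
    T.success N v μ n₁ n₂ ≤ 1 / 2 + 3 / 2 * K := by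
  -- Nonemptiness makes the quotient by the cardinality a genuine average.
  have hne : (Fintype.piFinset fun r => nearest (μ r) v).Nonempty :=
    Fintype.piFinset_nonempty.mpr fun r => nearest_nonempty hk (μ r) v
  have hcard : (0 : ℝ) < (Fintype.piFinset fun r => nearest (μ r) v).card := by
    exact_mod_cast hne.card_pos
  have havg : (∑ c ∈ Fintype.piFinset fun r => nearest (μ r) v,
      T.probYes ((schedule n₁ n₂).map (gate N v c))) /
        ((Fintype.piFinset fun r => nearest (μ r) v).card : ℝ)
      ≤ T.probYes ((schedule n₁ n₂).map fun _ => 1) + 3 * K := by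
    rw [div_le_iff₀ hcard, mul_comm, ← nsmul_eq_mul]
    refine Finset.sum_le_card_nsmul _ _ _ fun c _ => ?_
    have h := (le_abs_self _).trans (abs_probYes_sub_le T N v c (schedule n₁ n₂))
    linarith [hK c]
  rw [Strategy.success, probNo_eq T _ (by simp)]
  linarith

/-- The strategy that always guesses "has not participated". -/
noncomputable def guessNo : Strategy where
  m := 1
  ρ := (1 / 2 : ℂ) • 1
  ρ_psd := Matrix.PosSemidef.one.smul (by rw [Complex.le_def]; norm_num)
  ρ_trace := by simp [Matrix.trace_smul, Matrix.trace_one]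
  chan := fun _ => ⟨1, fun _ => 1, by simp⟩
  yes := 0
  yes_psd := Matrix.PosSemidef.zero
  no_psd := by simpa using Matrix.PosSemidef.one

lemma guessNo_success {R k d : ℕ} (N : ℕ) (v : EuclideanSpace ℝ (Fin d))
    (μ : Fin R → Fin k → EuclideanSpace ℝ (Fin d)) (n₁ : Fin R → ℕ)
    (n₂ : Fin R → Fin k → Fin d → ℕ) : guessNo.success N v μ n₁ n₂ = 1 / 2 := by
  have h : ∀ gs, guessNo.probYes gs = 0 := fun gs => by
    rw [Strategy.probYes, show guessNo.yes = 0 from rfl, zero_mul, Matrix.trace_zero,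
      Complex.zero_re]
  rw [Strategy.success, probNo_eq _ _ (by simp)]
  simp [h]

end QKMeans

theorem theorem3 (A L : ℝ) :
    ∃ C : ℝ, 0 < C ∧
      ∀ (N d k R : ℕ), 0 < d → 0 < k → 0 < R →
      ∀ (x : Fin N → EuclideanSpace ℝ (Fin d)) (b : Fin N) (S : Finset (Fin N))
        (μ : Fin R → Fin k → EuclideanSpace ℝ (Fin d)) (ε : ℝ)
        (n₁ : Fin R → ℕ) (n₂ : Fin R → Fin k → Fin d → ℕ),
        0 < ε →
        (∀ i, |x b i| ≤ L) →
        (∀ r, (n₁ r : ℝ) ≤ A / ε) →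
        (∀ r p, ((∑ i, n₂ r p i : ℕ) : ℝ) ≤ A * d / (ε * QKMeans.clusterProb x S (μ r) p)) →
        ε < QKMeans.minProb x S μ →
        ∃ Popt : ℝ,
          IsLUB {s : ℝ | ∃ T : QKMeans.Strategy, s = T.success N (x b) μ n₁ n₂} Popt ∧
          |Popt - 1 / 2| ≤ C * (R * d / (QKMeans.minProb x S μ * N * ε)) := by
  -- The argument needs only `3/4 * |A| * (1 + |L|)`; the summand `1` keeps the constant positive
  -- when `A = 0`.
  refine ⟨2 * (|A| * (1 + |L|)) + 1, by positivity, ?_⟩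
  intro N d k R hd hk _ x b S μ ε n₁ n₂ hε hx h₁ h₂ hP
  have hP0 : 0 < QKMeans.minProb x S μ := hε.trans hP
  have hQ : (0 : ℝ) ≤ R * d / (QKMeans.minProb x S μ * N * ε) := by positivity
  have hub : ∀ T : QKMeans.Strategy, T.success N (x b) μ n₁ n₂
      ≤ 1 / 2 + 3 / 2 * (|A| * (1 + |L|) / 2 * (R * d / (QKMeans.minProb x S μ * N * ε))) :=
    fun T => QKMeans.success_le hk T N (x b) μ n₁ n₂
      (QKMeans.sum_abs_gateAngle_le hd x b S μ n₁ n₂ hε hx h₁ h₂ hP0)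
  have hmem : (1 / 2 : ℝ) ∈ {s : ℝ | ∃ T : QKMeans.Strategy, s = T.success N (x b) μ n₁ n₂} :=
    ⟨QKMeans.guessNo, (QKMeans.guessNo_success N (x b) μ n₁ n₂).symm⟩
  obtain ⟨P, hlub⟩ := Real.exists_isLUB ⟨_, hmem⟩
    ⟨_, by rintro s ⟨T, rfl⟩; exact hub T⟩
  refine ⟨P, hlub, ?_⟩
  -- Constant guessing makes the advantage nonnegative, so only the upper bound remains.
  have hlo : 1 / 2 ≤ P := hlub.1 hmem
  have hhi := hlub.2 (by rintro s ⟨T, rfl⟩; exact hub T)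
  rw [abs_of_nonneg (sub_nonneg.mpr hlo)]
  have hAL : 0 ≤ |A| * (1 + |L|) * (R * d / (QKMeans.minProb x S μ * N * ε)) := by positivity
  linarith
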